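/- Let $\mathcal H$ be a complex Hilbert space, with inner product $\langle\cdot,\cdot\rangle$ linear in the first variable. A *resolution of the identity* on $\mathbb R$ is a family $\{X(\lambda)\}_{\lambda\in\mathbb R}$ of (not necessarily self-adjoint) bounded operators on $\mathcal H$ such that $\sup_{\lambda}\|X(\lambda)\|=:\gamma(X)<\infty$; $X(\lambda)X(\mu)=X(\mu)X(\lambda)=X(\lambda)$ if $\lambda<\mu$; and, for every $\xi\in\mathcal H$, $\lim_{\lambda\to-\infty}X(\lambda)\xi=0$, $\lim_{\lambda\to+\infty}X(\lambda)\xi=\xi$ and $\lim_{\epsilon\to0^+}X(\lambda+\epsilon)\xi=X(\lambda)\xi$ for every $\lambda$. It is a *\*-resolution of the identity* if $\{X(\lambda)^*\}$ is a resolution of the identity too. Let $\{X(\lambda)\}_{\lambda\in\mathbb R}$ be a \*-resolution of the identity with $\gamma(X)=1$, and put $F(\lambda)=X(\lambda)^*X(\lambda)$; for every $\xi$ the function $\lambda\mapsto\langle F(\lambda)\xi,\xi\rangle=\|X(\lambda)\xi\|^2$ is increasing and right-continuous. Set $$D(T_X)=\Big\{\xi\in\mathcal H:\ \int_{\mathbb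 R}\lambda^2\,d\langle F(\lambda)\xi,\xi\rangle<\infty\Big\},$$ and let $\mathcal D$ be the set of all $\xi\in\mathcal H$ such that the Lebesgue–Stieltjes integral $\Theta_\xi(\eta)=\int_{\mathbb R}\lambda\,d\langle X(\lambda)\xi,\eta\rangle$ exists for every $\eta\in\mathcal H$ (that is, $\lambda\mapsto\langle X(\lambda)\xi,\eta\rangle$ is of bounded variation on $\mathbb R$, and $\lambda$ is integrable with respect to the total variation of the complex Borel measure it determines), and such that $|\Theta_\xi(\eta)|\le C\|\eta\|$ for all $\eta\in\mathcal H$, with a constant $C$ that may depend on $\xi$. Then $\mathcal D=D(T_X)$. Moreover, for every $\xi\in D(T_X)$ and every $\eta\in\mathcal H$, $$\Big|\int_{\mathbb R}\lambda\,d\langle X(\lambda)\xi,\eta\rangle\Big|\le\Big(\int_{\mathbb R}\lambda^2\,d\langle F(\lambda)\xi,\xi\rangle\Big)^{1/2}\|\eta\|.$$ -/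

import Mathlib

open MeasureTheory Set Filter Topology

namespace NonSelfAdjointResolution

variable {H : Type*} [NormedAddCommGroup H] [InnerProductSpace ℂ H]

/-- `γ(X) = sup_t ‖X(t)‖`. It is only used for uniformly bounded families. -/
noncomputable def gamma (X : ℝ → H →L[ℂ] H) : ℝ := ⨆ t, ‖X t‖

/-- A (not necessarily self-adjoint) resolution of the identity on the real line. -/
structure IsResolution (X : ℝ → H →L[ℂ] H) : Prop where
  bddAbove : BddAbove (range fun t => ‖X t‖)
  comp_eq : ∀ s t, s < t → X s ∘L X t = X s ∧ X t ∘L X s = X s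
  tendsto_atBot : ∀ ξ, Tendsto (fun t => X t ξ) atBot (𝓝 0)
  tendsto_atTop : ∀ ξ, Tendsto (fun t => X t ξ) atTop (𝓝 ξ)
  tendsto_right : ∀ t ξ, Tendsto (fun ε => X (t + ε) ξ) (𝓝[>] 0) (𝓝 (X t ξ))

/-- A *-resolution of the identity: both `X(t)` and the adjoints `X(t)*` form a resolution. -/
structure IsStarResolution [CompleteSpace H] (X : ℝ → H →L[ℂ] H) : Prop where
  isResolution : IsResolution X
  adjoint : IsResolution fun t => ContinuousLinearMap.adjoint (X t)

/-- `F(t) = X(t)* X(t)`. -/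
noncomputable def F [CompleteSpace H] (X : ℝ → H →L[ℂ] H) (t : ℝ) : H →L[ℂ] H :=
  ContinuousLinearMap.adjoint (X t) ∘L X t

lemma re_inner_F [CompleteSpace H] (X : ℝ → H →L[ℂ] H) (t : ℝ) (ξ : H) :
    (inner ℂ ξ (F X t ξ)).re = ‖X t ξ‖ ^ 2 := by
  simp only [F, ContinuousLinearMap.comp_apply, ContinuousLinearMap.adjoint_inner_right]
  exact inner_self_eq_norm_sq (𝕜 := ℂ) (X t ξ)

lemma inner_F [CompleteSpace H] (X : ℝ → H →L[ℂ] H) (t : ℝ) (ξ : H) :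
    inner ℂ ξ (F X t ξ) = ((‖X t ξ‖ ^ 2 : ℝ) : ℂ) := by
  simp only [F, ContinuousLinearMap.comp_apply, ContinuousLinearMap.adjoint_inner_right]
  rw [inner_self_eq_norm_sq_to_K]
  push_cast
  rfl

lemma IsResolution.monotone_norm {X : ℝ → H →L[ℂ] H} (hX : IsResolution X)
    (hγ : gamma X = 1) (ξ : H) : Monotone fun t => ‖X t ξ‖ := by
  intro s t hst
  rcases hst.eq_or_lt with rfl | h
  · exact le_rfl
  have h1 : X s ξ = X s (X t ξ) := by
    conv_lhs => rw [← (hX.comp_eq s t h).1]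
    rfl
  have h2 : ‖X s‖ ≤ 1 := hγ ▸ le_ciSup hX.bddAbove s
  calc ‖X s ξ‖ = ‖X s (X t ξ)‖ := by rw [← h1]
    _ ≤ ‖X s‖ * ‖X t ξ‖ := (X s).le_opNorm _
    _ ≤ 1 * ‖X t ξ‖ := by gcongr
    _ = ‖X t ξ‖ := one_mul _

lemma IsResolution.continuousWithinAt {X : ℝ → H →L[ℂ] H} (hX : IsResolution X)
    (ξ : H) (t : ℝ) : ContinuousWithinAt (fun t => X t ξ) (Ici t) t := by
  rw [← continuousWithinAt_Ioi_iff_Ici]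
  have h1 : Tendsto (fun s : ℝ => s - t) (𝓝[>] t) (𝓝[>] 0) := by
    apply tendsto_nhdsWithin_of_tendsto_nhds_of_eventually_within
    · have : ContinuousAt (fun s : ℝ => s - t) t := by fun_prop
      have h := this.tendsto
      rw [sub_self] at h
      exact h.mono_left nhdsWithin_le_nhds
    · filter_upwards [self_mem_nhdsWithin] with s hs using sub_pos.2 (mem_Ioi.1 hs)
  have h2 := (hX.tendsto_right t ξ).comp h1
  refine h2.congr fun s => ?_
  simp

/-- The increasing right-continuous function `t ↦ ⟨F(t)ξ, ξ⟩`. Its Stieltjes measure is the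
measure denoted `d⟨F(t)ξ, ξ⟩`, with mass `⟨F(b)ξ, ξ⟩ - ⟨F(a)ξ, ξ⟩` on `(a, b]`. -/
noncomputable def stieltjesF [CompleteSpace H] {X : ℝ → H →L[ℂ] H} (hX : IsStarResolution X)
    (hγ : gamma X = 1) (ξ : H) : StieltjesFunction ℝ where
  toFun t := (inner ℂ ξ (F X t ξ)).re
  mono' := by
    intro s t hst
    simp only [re_inner_F]
    have := hX.isResolution.monotone_norm hγ ξ hst
    simp only at this
    gcongr
  right_continuous' t := by
    simp only [re_inner_F]
    exact (hX.isResolution.continuousWithinAt ξ t).norm.pow 2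

/-- `D(T_X)`: the vectors `ξ` with `∫ t² d⟨F(t)ξ, ξ⟩ < ∞`. -/
def domainT [CompleteSpace H] {X : ℝ → H →L[ℂ] H} (hX : IsStarResolution X)
    (hγ : gamma X = 1) : Set H :=
  {ξ | ∫⁻ t, ENNReal.ofReal (t ^ 2) ∂(stieltjesF hX hγ ξ).measure < ⊤}

/-- The Lebesgue-Stieltjes integral `∫ f dg` exists: `g` is of bounded variation on the line, and
`f` is integrable for the (total variation of the) complex Borel measure determined by `g`,
which is `g(b+) - g(a+)` on `(a, b]`. -/
def StieltjesIntegrable (f : ℝ → ℝ) (g : ℝ → ℂ) : Prop :=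
  ∃ h : BoundedVariationOn g univ, h.vectorMeasure.Integrable f

open scoped Classical in
/-- The Lebesgue-Stieltjes integral `∫ f dg` of a real function against the complex Borel measure
determined by `g`; it is `0` when it does not exist. -/
noncomputable def stieltjesIntegral (f : ℝ → ℝ) (g : ℝ → ℂ) : ℂ :=
  if h : BoundedVariationOn g univ then
    h.vectorMeasure.integral f (ContinuousLinearMap.lsmul ℝ ℝ)
  else 0

/-- The functional `Θ_ξ(η) = ∫ t d⟨X(t)ξ, η⟩`. The product `⟨·, ·⟩` here is linear in its first
variable, Mathlib's is linear in the second one. -/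
noncomputable def Θ (X : ℝ → H →L[ℂ] H) (ξ η : H) : ℂ :=
  stieltjesIntegral (fun t => t) fun t => inner ℂ η (X t ξ)

/-- The domain of `∫ t dX(t)`: all `ξ` for which `∫ t d⟨X(t)ξ, η⟩` exists for every `η` and is a
bounded functional of `η`. -/
def domainIntegral (X : ℝ → H →L[ℂ] H) : Set H :=
  {ξ | (∀ η, StieltjesIntegrable (fun t => t) fun t => inner ℂ η (X t ξ)) ∧
    ∃ C : ℝ, ∀ η, ‖Θ X ξ η‖ ≤ C * ‖η‖}

end NonSelfAdjointResolution

namespace NonSelfAdjointResolution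

open scoped ENNReal NNReal InnerProductSpace

/-! Since `γ(X) = 1`, every `X(t)` is a contractive idempotent, hence an orthogonal projection, and
increments of `X` over disjoint intervals are orthogonal. Write `μ_ξ` for the measure `d⟨F(t)ξ, ξ⟩`;
its mass on `(a, b]` is `‖X(b)ξ - X(a)ξ‖²`.

For `D(T_X) ⊆ 𝒟` and the final estimate, the total variation of `d⟨X(t)ξ, η⟩` is at most the
geometric mean of `μ_ξ` and `μ_η` on every set, so Cauchy-Schwarz bounds the integral of `|t|`
(`lintegral_variation_le`).

For `𝒟 ⊆ D(T_X)`, the functional `Θ_ξ` is tested on its own Riemann sum `η = ∑ k (X(k+1) - X(k))ξ`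
over `(-n, n]`. Replacing `t` by the step function turns `Θ_ξ(η)` into `‖η‖²`, with error at most
`‖ξ‖ ‖η‖`. Boundedness of `Θ_ξ` thus bounds `‖η‖` uniformly in `n`, and `‖η‖² = ∑ k² μ_ξ((k, k+1])`
controls the second moment of `μ_ξ` on `(-n, n]`. -/

/-! ### Variation bounds and Cauchy-Schwarz for dominated measures. -/

lemma monotone_Ioc_neg_nat : Monotone fun n : ℕ => Ioc (-(n : ℝ)) n := fun i j hij => by
  have : (i : ℝ) ≤ j := by exact_mod_cast hij
  exact Ioc_subset_Ioc (by linarith) this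

lemma iUnion_Ioc_neg_nat : ⋃ n : ℕ, Ioc (-(n : ℝ)) n = univ := by
  refine eq_univ_of_forall fun x => mem_iUnion.2 ?_
  obtain ⟨n, hn⟩ := exists_nat_gt |x|
  exact ⟨n, (abs_lt.1 hn).1, (abs_lt.1 hn).2.le⟩

/-- A vector measure on the line which is dominated by a finite measure on half-open intervals has
variation dominated by this measure. -/
theorem variation_vectorMeasure_le {E : Type*} [NormedAddCommGroup E] [CompleteSpace E]
    {g : ℝ → E} (hg : BoundedVariationOn g univ) (m : Measure ℝ) [IsFiniteMeasure m]
    (h : ∀ a b, a ≤ b → ‖g.rightLim b - g.rightLim a‖ₑ ≤ m (Ioc a b)) :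
    hg.vectorMeasure.variation ≤ m := by
  have hle : ∀ s ∈ {s : Set ℝ | ∃ u v, u ≤ v ∧ s = Ioc u v},
      ‖AddContent.onIoc g.rightLim s‖ₑ ≤ m s := by
    rintro s ⟨u, v, huv, rfl⟩
    rw [AddContent.onIoc_apply huv]
    exact h u v huv
  have hgen : (inferInstance : MeasurableSpace ℝ) =
      MeasurableSpace.generateFrom {s : Set ℝ | ∃ u v, u ≤ v ∧ s = Ioc u v} := by
    rw [BorelSpace.measurable_eq (α := ℝ), borel_eq_generateFrom_Ioc_le]
    refine congrArg MeasurableSpace.generateFrom (Set.ext fun s => ?_)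
    exact exists_congr fun _ => exists_congr fun _ => and_congr_right fun _ => eq_comm
  -- The bound is known on half-open intervals only. Extending the interval content yields a `ν`
  -- dominated by `m` on all sets; it remains to identify it with `hg.vectorMeasure`.
  obtain ⟨ν, hν, hνm⟩ :=
    VectorMeasure.exists_extension_of_isSetSemiring_of_le_measure_of_generateFrom
      IsSetSemiring.Ioc hle hgen
  have hIoc : ∀ a b : ℝ, a ≤ b → hg.vectorMeasure (Ioc a b) = ν (Ioc a b) := fun a b hab => by
    rw [hν _ ⟨a, b, hab, rfl⟩, AddContent.onIoc_apply hab, hg.vectorMeasure_Ioc hab]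
  have huniv : hg.vectorMeasure univ = ν univ := by
    rw [← iUnion_Ioc_neg_nat]
    refine tendsto_nhds_unique
      (hg.vectorMeasure.tendsto_vectorMeasure_iUnion_atTop_nat monotone_Ioc_neg_nat
        fun _ => measurableSet_Ioc) ?_
    refine (ν.tendsto_vectorMeasure_iUnion_atTop_nat monotone_Ioc_neg_nat
      fun _ => measurableSet_Ioc).congr fun n => (hIoc _ _ ?_).symm
    linarith [n.cast_nonneg (α := ℝ)]
  have heq : hg.vectorMeasure = ν := by
    refine VectorMeasure.ext_of_generateFrom _ ?_ hgen ?_ huniv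
    · rintro s ⟨a, b, hab, rfl⟩
      exact hIoc a b hab
    · rintro s ⟨a, b, -, rfl⟩ t ⟨c, d, -, rfl⟩ ⟨x, hx⟩
      rw [Ioc_inter_Ioc] at hx ⊢
      exact ⟨_, _, (hx.1.trans_le hx.2).le, rfl⟩
  rw [heq]
  exact VectorMeasure.variation_le_of_forall_enorm_le fun s _ => hνm s

/-- A function whose increments are dominated by a finite measure has bounded variation. -/
theorem boundedVariationOn_of_edist_le_measure {E : Type*} [PseudoEMetricSpace E] {g : ℝ → E}
    (m : Measure ℝ) [IsFiniteMeasure m] (h : ∀ a b, a ≤ b → edist (g b) (g a) ≤ m (Ioc a b)) :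
    BoundedVariationOn g univ := by
  refine ne_top_of_le_ne_top (measure_ne_top m univ) (iSup_le ?_)
  rintro ⟨n, u, hu, -⟩
  calc ∑ i ∈ Finset.range n, edist (g (u (i + 1))) (g (u i))
      ≤ ∑ i ∈ Finset.range n, m (Ioc (u i) (u (i + 1))) :=
        Finset.sum_le_sum fun i _ => h _ _ (hu i.le_succ)
    _ = m (⋃ i ∈ Finset.range n, Ioc (u i) (u (i + 1))) := by
        refine (measure_biUnion_finset ?_ fun _ _ => measurableSet_Ioc).symm
        exact fun i _ j _ hij => hu.pairwise_disjoint_on_Ioc_succ hij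
    _ ≤ m univ := measure_mono (subset_univ _)

/-- If a measure is dominated by all the weighted means of `μ` and `κ`, it is dominated by their
geometric mean. -/
theorem measure_le_geom_mean {α : Type*} [MeasurableSpace α] {V μ κ : Measure α}
    [IsFiniteMeasure μ] [IsFiniteMeasure κ]
    (h : ∀ c : ℝ≥0, c ≠ 0 → V ≤ (c / 2) • μ + (c⁻¹ / 2) • κ) (A : Set α) :
    V A ≤ μ A ^ (1 / 2 : ℝ) * κ A ^ (1 / 2 : ℝ) := by
  have hfin : V A ≠ ⊤ := ne_top_of_le_ne_top (measure_ne_top _ _) (h 1 one_ne_zero A)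
  obtain ⟨x, hx : (x : ℝ≥0∞) = _⟩ := WithTop.ne_top_iff_exists.1 (measure_ne_top μ A)
  obtain ⟨y, hy : (y : ℝ≥0∞) = _⟩ := WithTop.ne_top_iff_exists.1 (measure_ne_top κ A)
  obtain ⟨v, hv : (v : ℝ≥0∞) = _⟩ := WithTop.ne_top_iff_exists.1 hfin
  have key : ∀ t : ℝ, 0 < t → (v : ℝ) ≤ t / 2 * x + t⁻¹ / 2 * y := by
    intro t ht
    lift t to ℝ≥0 using ht.le
    have := h t (by exact_mod_cast ht.ne') A
    simp only [Measure.add_apply, Measure.smul_apply, ENNReal.smul_def, smul_eq_mul, ← hx, ← hy,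
      ← hv] at this
    exact_mod_cast this
  -- Multiplying `key` by `2t` gives `x t² - 2 v t + y ≥ 0` for `t > 0`; for `t ≤ 0` every term is
  -- nonnegative. The discriminant gives `v² ≤ x y`.
  have hd := discrim_le_zero (a := (x : ℝ)) (b := -2 * v) (c := y) fun t => by
    rcases le_or_gt t 0 with ht | ht
    · nlinarith [x.2, y.2, mul_nonneg x.2 (mul_self_nonneg t), mul_nonneg v.2 (neg_nonneg.2 ht)]
    · have h1 := mul_le_mul_of_nonneg_left (key t ht) ht.le
      have h2 : t * (t / 2 * x + t⁻¹ / 2 * y) = (t * t * x + y) / 2 := by field_simp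
      linarith
  have hv2 : (v : ℝ) ^ 2 ≤ x * y := by
    rw [discrim] at hd
    linarith
  have hv3 : (v : ℝ≥0∞) ^ (2 : ℝ) ≤ x * y := by
    rw [ENNReal.rpow_two]
    exact_mod_cast hv2
  rw [← hx, ← hy, ← hv, ← ENNReal.mul_rpow_of_nonneg _ _ (by norm_num), one_div,
    ENNReal.le_rpow_inv_iff (by norm_num)]
  exact hv3

/-- Cauchy-Schwarz for a measure dominated by a geometric mean of two measures. -/
theorem lintegral_le_of_le_geom_mean {α : Type*} [MeasurableSpace α] {V μ κ : Measure α}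
    (h : ∀ A, MeasurableSet A → V A ≤ μ A ^ (1 / 2 : ℝ) * κ A ^ (1 / 2 : ℝ))
    {f : α → ℝ≥0∞} (hf : Measurable f) :
    ∫⁻ t, f t ∂V ≤ (∫⁻ t, f t ^ 2 ∂μ) ^ (1 / 2 : ℝ) * κ univ ^ (1 / 2 : ℝ) := by
  -- For simple functions the claim is the finite Cauchy-Schwarz inequality over the level sets.
  rw [lintegral_eq_iSup_eapprox_lintegral hf]
  refine iSup_le fun n => ?_
  set φ := SimpleFunc.eapprox f n with hφ
  have hφf : ∀ t, φ t ≤ f t := fun t => by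
    rw [← SimpleFunc.iSup_eapprox_apply hf t]
    exact le_iSup (fun k => SimpleFunc.eapprox f k t) n
  have hsq : ∑ x ∈ φ.range, (x * μ (φ ⁻¹' {x}) ^ (1 / 2 : ℝ)) ^ (2 : ℝ) ≤ ∫⁻ t, f t ^ 2 ∂μ := by
    calc _ = (φ.map fun x => x ^ 2).lintegral μ := by
          rw [SimpleFunc.map_lintegral]
          refine Finset.sum_congr rfl fun x _ => ?_
          rw [ENNReal.mul_rpow_of_nonneg _ _ (by norm_num), ← ENNReal.rpow_mul]
          norm_num
      _ = ∫⁻ t, φ t ^ 2 ∂μ := by rw [← SimpleFunc.lintegral_eq_lintegral]; rfl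
      _ ≤ _ := lintegral_mono fun t => by gcongr; exact hφf t
  have hκ : ∑ x ∈ φ.range, (κ (φ ⁻¹' {x}) ^ (1 / 2 : ℝ)) ^ (2 : ℝ) = κ univ := by
    rw [← φ.sum_range_measure_preimage_singleton κ]
    refine Finset.sum_congr rfl fun x _ => ?_
    rw [← ENNReal.rpow_mul]
    norm_num
  calc φ.lintegral V = ∑ x ∈ φ.range, x * V (φ ⁻¹' {x}) := rfl
    _ ≤ ∑ x ∈ φ.range, (x * μ (φ ⁻¹' {x}) ^ (1 / 2 : ℝ)) * κ (φ ⁻¹' {x}) ^ (1 / 2 : ℝ) := by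
        refine Finset.sum_le_sum fun x _ => ?_
        rw [mul_assoc]
        gcongr
        exact h _ (φ.measurableSet_fiber x)
    _ ≤ _ := ENNReal.inner_le_Lp_mul_Lq _ _ _ Real.HolderConjugate.two_two
    _ ≤ _ := by rw [hκ]; gcongr

/-! ### Orthogonal projections and their increments. -/

variable {H : Type*} [NormedAddCommGroup H] [InnerProductSpace ℂ H]

/-- The composition law is assumed only for distinct parameters; right continuity supplies the
diagonal case. -/
lemma IsResolution.apply_apply {X : ℝ → H →L[ℂ] H} (hX : IsResolution X) (t : ℝ) (ξ : H) :
    X t (X t ξ) = X t ξ := by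
  have h1 : Tendsto (fun ε => X t (X (t + ε) ξ)) (𝓝[>] 0) (𝓝 (X t (X t ξ))) :=
    ((X t).continuous.tendsto _).comp (hX.tendsto_right t ξ)
  refine tendsto_nhds_unique h1 (tendsto_const_nhds.congr' ?_)
  filter_upwards [self_mem_nhdsWithin] with ε hε
  exact (DFunLike.congr_fun (hX.comp_eq t (t + ε) (lt_add_of_pos_right t hε)).1 ξ).symm

lemma IsResolution.apply_of_le {X : ℝ → H →L[ℂ] H} (hX : IsResolution X) {s t : ℝ} (h : s ≤ t)
    (ξ : H) : X s (X t ξ) = X s ξ ∧ X t (X s ξ) = X s ξ := by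
  rcases h.eq_or_lt with rfl | h
  · exact ⟨hX.apply_apply s ξ, hX.apply_apply s ξ⟩
  · exact ⟨DFunLike.congr_fun (hX.comp_eq s t h).1 ξ, DFunLike.congr_fun (hX.comp_eq s t h).2 ξ⟩

/-- A contractive idempotent is symmetric. -/
lemma inner_apply_left_of_idem [CompleteSpace H] {P : H →L[ℂ] H} (hP : ∀ ξ, P (P ξ) = P ξ)
    (h1 : ‖P‖ ≤ 1) (ξ η : H) : ⟪P ξ, η⟫_ℂ = ⟪ξ, P η⟫_ℂ := by
  -- Expanding, `‖P*Pu - Pu‖² = ‖P*Pu‖² - ‖Pu‖² ≤ 0`. Hence `P = P*P`, which is self-adjoint.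
  have hadj : ∀ u, ContinuousLinearMap.adjoint P (P u) = P u := by
    intro u
    have hn : ‖ContinuousLinearMap.adjoint P (P u)‖ ≤ ‖P u‖ := by
      refine (ContinuousLinearMap.le_opNorm _ _).trans ?_
      rw [LinearIsometryEquiv.norm_map]
      exact mul_le_of_le_one_left (norm_nonneg _) h1
    have hi : ⟪ContinuousLinearMap.adjoint P (P u), P u⟫_ℂ = ⟪P u, P u⟫_ℂ := by
      rw [ContinuousLinearMap.adjoint_inner_left, hP]
    have hsq := norm_sub_sq (𝕜 := ℂ) (ContinuousLinearMap.adjoint P (P u)) (P u)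
    rw [hi, inner_self_eq_norm_sq] at hsq
    have : ‖ContinuousLinearMap.adjoint P (P u) - P u‖ ^ 2 ≤ 0 := by
      rw [hsq]
      nlinarith [norm_nonneg (ContinuousLinearMap.adjoint P (P u)), norm_nonneg (P u)]
    exact sub_eq_zero.1 (norm_eq_zero.1 (pow_eq_zero_iff two_ne_zero |>.1
      (le_antisymm this (sq_nonneg _))))
  calc ⟪P ξ, η⟫_ℂ = ⟪ContinuousLinearMap.adjoint P (P ξ), η⟫_ℂ := by rw [hadj]
    _ = ⟪ξ, ContinuousLinearMap.adjoint P (P η)⟫_ℂ := by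
      rw [ContinuousLinearMap.adjoint_inner_left, ContinuousLinearMap.adjoint_inner_right]
    _ = ⟪ξ, P η⟫_ℂ := by rw [hadj]

variable [CompleteSpace H] {X : ℝ → H →L[ℂ] H}

lemma IsResolution.inner_apply_left (hX : IsResolution X) (hγ : gamma X = 1) (t : ℝ) (ξ η : H) :
    ⟪X t ξ, η⟫_ℂ = ⟪ξ, X t η⟫_ℂ :=
  inner_apply_left_of_idem (hX.apply_apply t) (hγ ▸ le_ciSup hX.bddAbove t) ξ η

lemma IsResolution.inner_sub_sub (hX : IsResolution X) (hγ : gamma X = 1) {s t : ℝ} (h : s ≤ t)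
    (ξ η : H) : ⟪X t η - X s η, X t ξ - X s ξ⟫_ℂ = ⟪η, X t ξ - X s ξ⟫_ℂ := by
  simp only [inner_sub_left, inner_sub_right, hX.inner_apply_left hγ, hX.apply_apply,
    (hX.apply_of_le h _).1, (hX.apply_of_le h _).2]
  ring

lemma IsResolution.inner_sub_sub_eq_zero (hX : IsResolution X) (hγ : gamma X = 1) {r s t u : ℝ}
    (hrs : r ≤ s) (hst : s ≤ t) (htu : t ≤ u) (ξ η : H) :
    ⟪X s η - X r η, X u ξ - X t ξ⟫_ℂ = 0 := by
  have hsu := hst.trans htu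
  have hrt := hrs.trans hst
  have hru := hrs.trans hsu
  simp only [inner_sub_left, inner_sub_right, hX.inner_apply_left hγ,
    (hX.apply_of_le hsu _).1, (hX.apply_of_le hst _).1,
    (hX.apply_of_le hrt _).1, (hX.apply_of_le hru _).1]
  ring

lemma IsResolution.norm_sub_sq (hX : IsResolution X) (hγ : gamma X = 1) {s t : ℝ} (h : s ≤ t)
    (ξ : H) : ‖X t ξ - X s ξ‖ ^ 2 = ‖X t ξ‖ ^ 2 - ‖X s ξ‖ ^ 2 := by
  have hi : ⟪X t ξ, X s ξ⟫_ℂ = ⟪X s ξ, X s ξ⟫_ℂ := by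
    rw [hX.inner_apply_left hγ, hX.inner_apply_left hγ, (hX.apply_of_le h ξ).2, hX.apply_apply]
  rw [_root_.norm_sub_sq (𝕜 := ℂ), hi, inner_self_eq_norm_sq]
  ring

/-! ### The measures `μ_ξ` and the variation of `d⟨X(t)ξ, η⟩`. -/

lemma stieltjesF_apply (hX : IsStarResolution X) (hγ : gamma X = 1) (ξ : H) (t : ℝ) :
    stieltjesF hX hγ ξ t = ‖X t ξ‖ ^ 2 := re_inner_F X t ξ

lemma measure_stieltjesF_Ioc (hX : IsStarResolution X) (hγ : gamma X = 1) (ξ : H) {a b : ℝ}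
    (h : a ≤ b) :
    (stieltjesF hX hγ ξ).measure (Ioc a b) = ENNReal.ofReal (‖X b ξ - X a ξ‖ ^ 2) := by
  rw [StieltjesFunction.measure_Ioc, stieltjesF_apply, stieltjesF_apply,
    hX.isResolution.norm_sub_sq hγ h]

lemma measure_stieltjesF_univ (hX : IsStarResolution X) (hγ : gamma X = 1) (ξ : H) :
    (stieltjesF hX hγ ξ).measure univ = ENNReal.ofReal (‖ξ‖ ^ 2) := by
  have h0 : Tendsto (stieltjesF hX hγ ξ) atBot (𝓝 0) := by
    have := (hX.isResolution.tendsto_atBot ξ).norm.pow 2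
    simp only [norm_zero, ne_eq, OfNat.ofNat_ne_zero, not_false_eq_true, zero_pow] at this
    exact this.congr fun t => (stieltjesF_apply hX hγ ξ t).symm
  have h1 : Tendsto (stieltjesF hX hγ ξ) atTop (𝓝 (‖ξ‖ ^ 2)) :=
    ((hX.isResolution.tendsto_atTop ξ).norm.pow 2).congr
      fun t => (stieltjesF_apply hX hγ ξ t).symm
  rw [StieltjesFunction.measure_univ _ h0 h1, sub_zero]

instance isFiniteMeasure_stieltjesF (hX : IsStarResolution X) (hγ : gamma X = 1) (ξ : H) :
    IsFiniteMeasure (stieltjesF hX hγ ξ).measure :=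
  ⟨by rw [measure_stieltjesF_univ]; exact ENNReal.ofReal_lt_top⟩

/-- Cauchy-Schwarz on increments followed by the weighted AM-GM inequality. The weighted sum, unlike
a geometric mean, is a measure, so it can dominate the variation; `c` is optimised afterwards, set
by set. -/
lemma enorm_inner_sub_le (hX : IsStarResolution X) (hγ : gamma X = 1) (ξ η : H) {c : ℝ≥0}
    (hc : c ≠ 0) {a b : ℝ} (h : a ≤ b) :
    ‖⟪η, X b ξ⟫_ℂ - ⟪η, X a ξ⟫_ℂ‖ₑ ≤ ((c / 2) • (stieltjesF hX hγ ξ).measure +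
      (c⁻¹ / 2) • (stieltjesF hX hγ η).measure) (Ioc a b) := by
  have hc' : (0 : ℝ) < c := by exact_mod_cast pos_iff_ne_zero.2 hc
  simp only [Measure.add_apply, Measure.smul_apply, ENNReal.smul_def, smul_eq_mul,
    measure_stieltjesF_Ioc hX hγ _ h]
  rw [← ENNReal.ofReal_coe_nnreal, ← ENNReal.ofReal_coe_nnreal,
    ← ENNReal.ofReal_mul (NNReal.coe_nonneg _), ← ENNReal.ofReal_mul (NNReal.coe_nonneg _),
    ← ENNReal.ofReal_add (by positivity) (by positivity), ← ofReal_norm]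
  refine ENNReal.ofReal_le_ofReal ?_
  rw [← inner_sub_right, ← hX.isResolution.inner_sub_sub hγ h]
  refine (norm_inner_le_norm _ _).trans ?_
  push_cast
  set x := ‖X b ξ - X a ξ‖
  set y := ‖X b η - X a η‖
  have key : (c : ℝ) / 2 * x ^ 2 + (c : ℝ)⁻¹ / 2 * y ^ 2 - y * x =
      (c : ℝ)⁻¹ / 2 * (c * x - y) ^ 2 := by
    field_simp
    ring
  have : 0 ≤ (c : ℝ)⁻¹ / 2 * (c * x - y) ^ 2 := by positivity
  linarith

lemma boundedVariationOn_inner (hX : IsStarResolution X) (hγ : gamma X = 1) (ξ η : H) :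
    BoundedVariationOn (fun t => ⟪η, X t ξ⟫_ℂ) univ :=
  boundedVariationOn_of_edist_le_measure _ fun a b hab => by
    rw [edist_eq_enorm_sub]
    exact enorm_inner_sub_le hX hγ ξ η one_ne_zero hab

lemma rightLim_inner (hX : IsStarResolution X) (ξ η : H) :
    Function.rightLim (fun t => ⟪η, X t ξ⟫_ℂ) = fun t => ⟪η, X t ξ⟫_ℂ :=
  funext fun t => ContinuousWithinAt.rightLim_eq <|
    ContinuousWithinAt.inner (𝕜 := ℂ) continuousWithinAt_const
      (hX.isResolution.continuousWithinAt ξ t)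

/-- The Cauchy-Schwarz inequality for the total variation of `d⟨X(t)ξ, η⟩`. -/
lemma setLIntegral_variation_le (hX : IsStarResolution X) (hγ : gamma X = 1) (ξ η : H)
    (hg : BoundedVariationOn (fun t => ⟪η, X t ξ⟫_ℂ) univ) {f : ℝ → ℝ≥0∞} (hf : Measurable f)
    (S : Set ℝ) :
    ∫⁻ t in S, f t ∂hg.vectorMeasure.variation ≤
      (∫⁻ t in S, f t ^ 2 ∂(stieltjesF hX hγ ξ).measure) ^ (1 / 2 : ℝ) *
        (stieltjesF hX hγ η).measure S ^ (1 / 2 : ℝ) := by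
  have h := fun A => measure_le_geom_mean (V := hg.vectorMeasure.variation)
    (μ := (stieltjesF hX hγ ξ).measure) (κ := (stieltjesF hX hγ η).measure) (fun c hc => by
      refine variation_vectorMeasure_le hg _ fun a b hab => ?_
      rw [rightLim_inner hX]
      exact enorm_inner_sub_le hX hγ ξ η hc hab) A
  have := lintegral_le_of_le_geom_mean (V := hg.vectorMeasure.variation.restrict S)
    (μ := (stieltjesF hX hγ ξ).measure.restrict S) (κ := (stieltjesF hX hγ η).measure.restrict S)
    (fun A hA => by simpa only [Measure.restrict_apply hA] using h (A ∩ S)) hf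
  rwa [Measure.restrict_apply_univ] at this

lemma lintegral_variation_le (hX : IsStarResolution X) (hγ : gamma X = 1) (ξ η : H)
    (hg : BoundedVariationOn (fun t => ⟪η, X t ξ⟫_ℂ) univ) {f : ℝ → ℝ≥0∞} (hf : Measurable f) :
    ∫⁻ t, f t ∂hg.vectorMeasure.variation ≤
      (∫⁻ t, f t ^ 2 ∂(stieltjesF hX hγ ξ).measure) ^ (1 / 2 : ℝ) * ‖η‖ₑ := by
  have := setLIntegral_variation_le hX hγ ξ η hg hf univ
  rw [setLIntegral_univ, setLIntegral_univ, measure_stieltjesF_univ,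
    ENNReal.ofReal_rpow_of_nonneg (by positivity) (by norm_num), ← Real.sqrt_eq_rpow,
    Real.sqrt_sq (norm_nonneg _), ofReal_norm] at this
  exact this

lemma enorm_sq_eq_ofReal (t : ℝ) : ‖t‖ₑ ^ 2 = ENNReal.ofReal (t ^ 2) := by
  rw [← ofReal_norm, ← ENNReal.ofReal_pow (norm_nonneg _), Real.norm_eq_abs, sq_abs]

lemma enorm_integral_lsmul_le {ν : VectorMeasure ℝ ℂ} (f : ℝ → ℝ) :
    ‖ν.integral f (ContinuousLinearMap.lsmul ℝ ℝ)‖ₑ ≤ ∫⁻ t, ‖f t‖ₑ ∂ν.variation := by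
  refine VectorMeasure.enorm_integral_le_lintegral_enorm.trans ?_
  refine mul_le_of_le_one_left (zero_le) ?_
  rw [← ofReal_norm]
  exact ENNReal.ofReal_le_one.2 ContinuousLinearMap.opNorm_lsmul_le

lemma integrable_of_mem_domainT (hX : IsStarResolution X) (hγ : gamma X = 1) {ξ : H}
    (hξ : ξ ∈ domainT hX hγ) (η : H) :
    StieltjesIntegrable (fun t => t) fun t => ⟪η, X t ξ⟫_ℂ := by
  refine ⟨boundedVariationOn_inner hX hγ ξ η, measurable_id.aestronglyMeasurable, ?_⟩
  refine (lintegral_variation_le hX hγ ξ η _ measurable_enorm).trans_lt ?_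
  simp only [enorm_sq_eq_ofReal]
  exact ENNReal.mul_lt_top (ENNReal.rpow_lt_top_of_nonneg (by norm_num) (ne_of_lt hξ))
    enorm_lt_top

lemma norm_Θ_le (hX : IsStarResolution X) (hγ : gamma X = 1) {ξ : H}
    (hξ : ξ ∈ domainT hX hγ) (η : H) :
    ‖Θ X ξ η‖ ≤ √(∫ t, t ^ 2 ∂(stieltjesF hX hγ ξ).measure) * ‖η‖ := by
  have hg := boundedVariationOn_inner hX hγ ξ η
  have h := (enorm_integral_lsmul_le (ν := hg.vectorMeasure) fun t => t).trans
    (lintegral_variation_le hX hγ ξ η hg measurable_enorm)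
  have hint : Integrable (fun t : ℝ => t ^ 2) (stieltjesF hX hγ ξ).measure := by
    refine ⟨(measurable_id.pow_const 2).aestronglyMeasurable, ?_⟩
    rw [hasFiniteIntegral_iff_ofReal (Eventually.of_forall fun t => sq_nonneg t)]
    exact hξ
  simp only [enorm_sq_eq_ofReal] at h
  rw [← ofReal_integral_eq_lintegral_ofReal hint (Eventually.of_forall fun t => sq_nonneg t),
    ENNReal.ofReal_rpow_of_nonneg (integral_nonneg fun t => sq_nonneg t) (by norm_num),
    ← Real.sqrt_eq_rpow, ← ofReal_norm, ← ofReal_norm,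
    ← ENNReal.ofReal_mul (Real.sqrt_nonneg _), ENNReal.ofReal_le_ofReal_iff (by positivity)] at h
  rwa [Θ, stieltjesIntegral, dif_pos hg]

/-! ### Riemann sums and the converse inclusion. -/

/-- The discretisation `∑ k (X(k + 1) - X(k)) ξ`, `-n ≤ k < n`, of `∫ t dX(t)ξ` on `(-n, n]`. -/
noncomputable def riemannSum (X : ℝ → H →L[ℂ] H) (ξ : H) (n : ℕ) : H :=
  ∑ k ∈ Finset.Ico (-n : ℤ) n, (k : ℂ) • (X (k + 1) ξ - X k ξ)

/-- The step function which is `k` on `(k, k + 1]` for `-n ≤ k < n`. -/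
noncomputable def step (n : ℕ) (t : ℝ) : ℝ :=
  ∑ k ∈ Finset.Ico (-n : ℤ) n, (Ioc (k : ℝ) (k + 1)).indicator (fun _ => (k : ℝ)) t

lemma exists_mem_Ioc_int {n : ℕ} {t : ℝ} (ht : t ∈ Ioc (-(n : ℝ)) n) :
    ∃ k ∈ Finset.Ico (-n : ℤ) n, t ∈ Ioc (k : ℝ) (k + 1) := by
  refine ⟨⌈t⌉ - 1, ?_, ?_, ?_⟩
  · have h1 : (-n : ℤ) < ⌈t⌉ := Int.lt_ceil.2 (by push_cast; exact ht.1)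
    have h2 : ⌈t⌉ ≤ (n : ℤ) := Int.ceil_le.2 (by push_cast; exact ht.2)
    rw [Finset.mem_Ico]
    omega
  · push_cast
    linarith [Int.ceil_lt_add_one t]
  · push_cast
    linarith [Int.le_ceil t]

lemma step_eq {n : ℕ} {k : ℤ} (hk : k ∈ Finset.Ico (-n : ℤ) n) {t : ℝ}
    (ht : t ∈ Ioc (k : ℝ) (k + 1)) : step n t = k := by
  rw [step, Finset.sum_eq_single_of_mem k hk, indicator_of_mem ht]
  intro j _ hjk
  refine indicator_of_notMem (fun htj => ?_) _
  exact disjoint_left.1 (pairwise_disjoint_Ioc_intCast ℝ hjk) htj ht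

lemma measurable_step (n : ℕ) : Measurable (step n) :=
  Finset.measurable_sum _ fun _ _ => measurable_const.indicator measurableSet_Ioc

lemma inner_riemannSum (hX : IsResolution X) (hγ : gamma X = 1) (ξ : H) {n : ℕ} {k : ℤ}
    (hk : k ∈ Finset.Ico (-n : ℤ) n) :
    ⟪riemannSum X ξ n, X (k + 1) ξ - X k ξ⟫_ℂ = k * (‖X (k + 1) ξ - X k ξ‖ ^ 2 : ℝ) := by
  rw [riemannSum, sum_inner, Finset.sum_eq_single_of_mem k hk]
  · rw [inner_smul_left, inner_self_eq_norm_sq_to_K]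
    simp
  · intro j _ hjk
    rw [inner_smul_left]
    rcases lt_or_gt_of_ne hjk with h | h
    · have h' : (j : ℝ) + 1 ≤ k := by exact_mod_cast h
      rw [hX.inner_sub_sub_eq_zero hγ (by linarith) h' (by linarith), mul_zero]
    · have h' : (k : ℝ) + 1 ≤ j := by exact_mod_cast h
      rw [← inner_conj_symm, hX.inner_sub_sub_eq_zero hγ (by linarith) h' (by linarith), map_zero,
        mul_zero]

lemma inner_riemannSum_self (X : ℝ → H →L[ℂ] H) (ξ : H) (n : ℕ) :
    ∑ k ∈ Finset.Ico (-n : ℤ) n, (k : ℂ) * ⟪riemannSum X ξ n, X (k + 1) ξ - X k ξ⟫_ℂ =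
      (‖riemannSum X ξ n‖ ^ 2 : ℝ) := by
  have h := inner_self_eq_norm_sq_to_K (𝕜 := ℂ) (riemannSum X ξ n)
  conv at h => enter [1, 3]; rw [riemannSum]
  rw [inner_sum] at h
  simp only [inner_smul_right] at h
  rw [h]
  push_cast
  rfl

lemma norm_riemannSum_sq (hX : IsResolution X) (hγ : gamma X = 1) (ξ : H) (n : ℕ) :
    ‖riemannSum X ξ n‖ ^ 2 =
      ∑ k ∈ Finset.Ico (-n : ℤ) n, (k : ℝ) ^ 2 * ‖X (k + 1) ξ - X k ξ‖ ^ 2 := by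
  have h := inner_riemannSum_self X ξ n
  rw [Finset.sum_congr rfl fun k hk => by rw [inner_riemannSum hX hγ ξ hk]] at h
  have h2 : ((‖riemannSum X ξ n‖ ^ 2 : ℝ) : ℂ) =
      (∑ k ∈ Finset.Ico (-n : ℤ) n, (k : ℝ) ^ 2 * ‖X (k + 1) ξ - X k ξ‖ ^ 2 : ℝ) := by
    rw [← h]
    push_cast
    exact Finset.sum_congr rfl fun k _ => by ring
  exact_mod_cast h2

/-- The Riemann sum lies in the range of the projection `X(n) - X(-n)`, so all its mass sits on
`(-n, n]`. This kills the discretisation error outside that interval. -/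
lemma measure_stieltjesF_riemannSum (hX : IsStarResolution X) (hγ : gamma X = 1) (ξ : H) (n : ℕ) :
    (stieltjesF hX hγ (riemannSum X ξ n)).measure (Ioc (-(n : ℝ)) n)ᶜ = 0 := by
  have hn : -(n : ℝ) ≤ n := by linarith [n.cast_nonneg (α := ℝ)]
  rw [measure_compl measurableSet_Ioc (measure_ne_top _ _), measure_stieltjesF_univ,
    measure_stieltjesF_Ioc hX hγ _ hn]
  have hmem : X n (riemannSum X ξ n) - X (-n) (riemannSum X ξ n) = riemannSum X ξ n := by
    simp only [riemannSum, map_sum, ← Finset.sum_sub_distrib, map_smul, map_sub, ← smul_sub]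
    refine Finset.sum_congr rfl fun k hk => ?_
    obtain ⟨h1, h2⟩ := Finset.mem_Ico.1 hk
    have h1' : -(n : ℝ) ≤ k := by exact_mod_cast h1
    have h2' : (k : ℝ) + 1 ≤ n := by exact_mod_cast h2
    have h3 : -(n : ℝ) ≤ k + 1 := by linarith
    have h4 : (k : ℝ) ≤ n := by linarith
    rw [(hX.isResolution.apply_of_le h2' ξ).2, (hX.isResolution.apply_of_le h4 ξ).2,
      (hX.isResolution.apply_of_le h3 ξ).1, (hX.isResolution.apply_of_le h1' ξ).1]
    simp
  rw [hmem, tsub_self]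

lemma norm_riemannSum_le (hX : IsStarResolution X) (hγ : gamma X = 1) {ξ : H}
    (hξ : ∀ η, StieltjesIntegrable (fun t => t) fun t => ⟪η, X t ξ⟫_ℂ) {C : ℝ}
    (hC : ∀ η, ‖Θ X ξ η‖ ≤ C * ‖η‖) (n : ℕ) : ‖riemannSum X ξ n‖ ≤ |C| + ‖ξ‖ := by
  set η := riemannSum X ξ n with hη
  obtain ⟨hg, hint⟩ := hξ η
  have hΘ : Θ X ξ η = hg.vectorMeasure.integral (fun t => t) (ContinuousLinearMap.lsmul ℝ ℝ) := by
    rw [Θ, stieltjesIntegral, dif_pos hg]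
  -- Finite variation makes constants, hence the step function, integrable.
  have : IsFiniteMeasure hg.vectorMeasure.variation := by
    refine ⟨?_⟩
    have := lintegral_variation_le hX hγ ξ η hg (f := 1) measurable_one
    simp only [Pi.one_apply, one_pow, lintegral_one] at this
    exact this.trans_lt (ENNReal.mul_lt_top
      (ENNReal.rpow_lt_top_of_nonneg (by norm_num) (measure_ne_top _ _)) enorm_lt_top)
  have hind : ∀ k ∈ Finset.Ico (-n : ℤ) n, hg.vectorMeasure.Integrable
      ((Ioc (k : ℝ) (k + 1)).indicator fun _ => (k : ℝ)) := fun k _ =>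
    (integrable_const _).indicator measurableSet_Ioc
  have hstep : hg.vectorMeasure.integral (step n) (ContinuousLinearMap.lsmul ℝ ℝ) =
      (‖η‖ ^ 2 : ℝ) := by
    rw [← inner_riemannSum_self, ← hη]
    refine (VectorMeasure.integral_finsetSum _ hind).trans (Finset.sum_congr rfl fun k _ => ?_)
    rw [VectorMeasure.integral_indicator_const _ measurableSet_Ioc,
      hg.vectorMeasure_Ioc (by linarith), rightLim_inner hX,
      ContinuousLinearMap.lsmul_apply, Complex.real_smul, inner_sub_right]
    simp
  have hstepint : hg.vectorMeasure.Integrable (step n) := integrable_finsetSum _ hind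
  -- On `(-n, n]` the step function is within `1` of `t`; outside, `μ_η` vanishes.
  have hdiff : ‖Θ X ξ η - (‖η‖ ^ 2 : ℝ)‖ₑ ≤ ‖ξ‖ₑ * ‖η‖ₑ := by
    rw [← hstep, hΘ, ← VectorMeasure.integral_sub hint hstepint]
    have hm : Measurable fun t => ‖t - step n t‖ₑ := (measurable_id.sub (measurable_step n)).enorm
    refine (enorm_integral_lsmul_le _).trans ?_
    rw [← lintegral_add_compl _ (measurableSet_Ioc (a := -(n : ℝ)) (b := n))]
    have h1 := setLIntegral_variation_le hX hγ ξ η hg hm (Ioc (-(n : ℝ)) n)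
    have h2 := setLIntegral_variation_le hX hγ ξ η hg hm (Ioc (-(n : ℝ)) n)ᶜ
    rw [measure_stieltjesF_riemannSum, ENNReal.zero_rpow_of_pos (by norm_num), mul_zero] at h2
    have h3 : ∫⁻ t in Ioc (-(n : ℝ)) n, ‖t - step n t‖ₑ ^ 2 ∂(stieltjesF hX hγ ξ).measure ≤
        (stieltjesF hX hγ ξ).measure univ := by
      calc _ ≤ ∫⁻ t in Ioc (-(n : ℝ)) n, 1 ∂(stieltjesF hX hγ ξ).measure := by
            refine setLIntegral_mono measurable_const fun t ht => ?_
            obtain ⟨k, hk, htk⟩ := exists_mem_Ioc_int ht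
            rw [step_eq hk htk, enorm_sq_eq_ofReal]
            refine ENNReal.ofReal_le_one.2 ?_
            nlinarith [htk.1, htk.2]
        _ ≤ _ := by
            rw [setLIntegral_one]
            exact measure_mono (subset_univ _)
    have hsq : ∀ ζ : H, (stieltjesF hX hγ ζ).measure univ ^ (1 / 2 : ℝ) = ‖ζ‖ₑ := fun ζ => by
      rw [measure_stieltjesF_univ, ENNReal.ofReal_rpow_of_nonneg (by positivity) (by norm_num),
        ← Real.sqrt_eq_rpow, Real.sqrt_sq (norm_nonneg _), ofReal_norm]
    calc _ ≤ (stieltjesF hX hγ ξ).measure univ ^ (1 / 2 : ℝ) *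
          (stieltjesF hX hγ η).measure univ ^ (1 / 2 : ℝ) + 0 := by
          refine add_le_add (h1.trans ?_) h2
          gcongr
          exact subset_univ _
      _ = _ := by rw [hsq, hsq, add_zero]
  rw [← ofReal_norm, ← ofReal_norm, ← ofReal_norm, ← ENNReal.ofReal_mul (norm_nonneg _),
    ENNReal.ofReal_le_ofReal_iff (by positivity)] at hdiff
  have h1 : ‖((‖η‖ ^ 2 : ℝ) : ℂ)‖ = ‖η‖ ^ 2 := by
    rw [Complex.norm_real, Real.norm_of_nonneg (sq_nonneg _)]
  have h2 := norm_sub_norm_le ((‖η‖ ^ 2 : ℝ) : ℂ) (Θ X ξ η)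
  rw [h1, norm_sub_rev] at h2
  have h3 := hC η
  -- Now `‖η‖² ≤ (|C| + ‖ξ‖) ‖η‖`, and one divides by `‖η‖` unless it is zero.
  have h4 : C * ‖η‖ ≤ |C| * ‖η‖ := by gcongr; exact le_abs_self C
  rcases (norm_nonneg η).eq_or_lt with h0 | h0
  · rw [← h0]
    positivity
  · nlinarith

lemma setLIntegral_sq_le (hX : IsStarResolution X) (hγ : gamma X = 1) (ξ : H) (n : ℕ) :
    ∫⁻ t in Ioc (-(n : ℝ)) n, ENNReal.ofReal (t ^ 2) ∂(stieltjesF hX hγ ξ).measure ≤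
      ENNReal.ofReal (2 * ‖riemannSum X ξ n‖ ^ 2) + 2 * (stieltjesF hX hγ ξ).measure univ := by
  set μ := (stieltjesF hX hγ ξ).measure
  have hsub : Ioc (-(n : ℝ)) n ⊆ ⋃ k ∈ Finset.Ico (-n : ℤ) n, Ioc (k : ℝ) (k + 1) := fun t ht => by
    obtain ⟨k, hk, htk⟩ := exists_mem_Ioc_int ht
    exact mem_biUnion hk htk
  have hdisj : (Finset.Ico (-n : ℤ) n : Set ℤ).PairwiseDisjoint fun k : ℤ => Ioc (k : ℝ) (k + 1) :=
    fun i _ j _ hij => pairwise_disjoint_Ioc_intCast ℝ hij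
  calc _ ≤ ∫⁻ t in ⋃ k ∈ Finset.Ico (-n : ℤ) n, Ioc (k : ℝ) (k + 1), ENNReal.ofReal (t ^ 2) ∂μ :=
        lintegral_mono_set hsub
    _ = ∑ k ∈ Finset.Ico (-n : ℤ) n, ∫⁻ t in Ioc (k : ℝ) (k + 1), ENNReal.ofReal (t ^ 2) ∂μ :=
        lintegral_biUnion_finset hdisj (fun _ _ => measurableSet_Ioc) _
    _ ≤ ∑ k ∈ Finset.Ico (-n : ℤ) n, (ENNReal.ofReal (2 * (k : ℝ) ^ 2) + 2) *
          μ (Ioc (k : ℝ) (k + 1)) := by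
        refine Finset.sum_le_sum fun k _ => ?_
        rw [← setLIntegral_const]
        refine setLIntegral_mono measurable_const fun t ht => ?_
        rw [← ENNReal.ofReal_ofNat 2, ← ENNReal.ofReal_add (by positivity) (by norm_num)]
        refine ENNReal.ofReal_le_ofReal ?_
        -- `t² ≤ 2k² + 2(t - k)²`, with difference `(2k - t)²`, and `0 < t - k ≤ 1`.
        nlinarith [ht.1, ht.2, sq_nonneg (2 * k - t : ℝ)]
    _ = ENNReal.ofReal (2 * ‖riemannSum X ξ n‖ ^ 2) +
          2 * μ (⋃ k ∈ Finset.Ico (-n : ℤ) n, Ioc (k : ℝ) (k + 1)) := by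
        rw [measure_biUnion_finset hdisj fun _ _ => measurableSet_Ioc, Finset.mul_sum,
          norm_riemannSum_sq hX.isResolution hγ, Finset.mul_sum,
          ENNReal.ofReal_sum_of_nonneg fun _ _ => by positivity, ← Finset.sum_add_distrib]
        refine Finset.sum_congr rfl fun k _ => ?_
        rw [add_mul, measure_stieltjesF_Ioc hX hγ ξ (by linarith),
          ← ENNReal.ofReal_mul (by positivity), mul_assoc]
    _ ≤ _ := by gcongr; exact subset_univ _

lemma mem_domainT_of_mem_domainIntegral (hX : IsStarResolution X) (hγ : gamma X = 1) {ξ : H}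
    (hξ : ξ ∈ domainIntegral X) : ξ ∈ domainT hX hγ := by
  obtain ⟨hint, C, hC⟩ := hξ
  rw [domainT, mem_ofPred_eq, ← setLIntegral_univ, ← iUnion_Ioc_neg_nat,
    setLIntegral_iUnion_of_directed _ monotone_Ioc_neg_nat.directed_le]
  refine (iSup_le fun n => ?_ : _ ≤ ENNReal.ofReal (2 * (|C| + ‖ξ‖) ^ 2) +
    2 * (stieltjesF hX hγ ξ).measure univ).trans_lt ?_
  · refine (setLIntegral_sq_le hX hγ ξ n).trans ?_
    gcongr
    exact norm_riemannSum_le hX hγ hint hC n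
  · exact ENNReal.add_lt_top.2 ⟨ENNReal.ofReal_lt_top,
      ENNReal.mul_lt_top (by norm_num) (measure_lt_top _ _)⟩

end NonSelfAdjointResolution

theorem lemma3p18 {H : Type*} [NormedAddCommGroup H] [InnerProductSpace ℂ H] [CompleteSpace H]
    (X : ℝ → H →L[ℂ] H) (hX : NonSelfAdjointResolution.IsStarResolution X)
    (hγ : NonSelfAdjointResolution.gamma X = 1) :
    NonSelfAdjointResolution.domainIntegral X = NonSelfAdjointResolution.domainT hX hγ ∧
    ∀ ξ ∈ NonSelfAdjointResolution.domainT hX hγ, ∀ η : H,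
      ‖NonSelfAdjointResolution.Θ X ξ η‖ ≤
        Real.sqrt (∫ t, t ^ 2 ∂(NonSelfAdjointResolution.stieltjesF hX hγ ξ).measure) * ‖η‖ := by
  refine ⟨Set.Subset.antisymm
    (fun ξ hξ => NonSelfAdjointResolution.mem_domainT_of_mem_domainIntegral hX hγ hξ)
    fun ξ hξ => ⟨NonSelfAdjointResolution.integrable_of_mem_domainT hX hγ hξ, _,
      NonSelfAdjointResolution.norm_Θ_le hX hγ hξ⟩,
    fun ξ hξ => NonSelfAdjointResolution.norm_Θ_le hX hγ hξ⟩
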